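/- All Lie groups are real, finite-dimensional and smooth. Two Lie groups $G_1, G_2$ form a \emph{matched pair} if there is a Lie group $D = G_1 \bowtie G_2$ (a double Lie group) containing $G_1$ and $G_2$ as closed Lie subgroups such that multiplication $G_1 \times G_2 \to D$, $(g,\gamma) \mapsto g\gamma$, is a diffeomorphism. The factorization $g\gamma = {}^{g}\gamma\; g^{\gamma}$ in $D$, with ${}^{g}\gamma \in G_2$ and $g^{\gamma} \in G_1$, then defines a left action of $G_1$ on $G_2$ and a right action of $G_2$ on $G_1$. Let $H$ and $H^\perp$ be connected Lie groups such that $(H, H^\perp)$ forms a matched pair (for instance, a connected closed coisotropic subgroup $H$ of a Poisson Lie group $G$ and the connected subgroup $H^\perp$ of the dual group $G^*$ that integrates the annihilator $\mathfrak h^\perp \subset \mathfrak g^*$ of the Lie algebra $\mathfrak h$ of $H$, when their dressing actions integrate to a matched pair). Let $p : \tilde H \to H$ be the universal cover of $H$, i.e. $\tilde H$ is a connected, simply connected Lie group and $p$ is a smooth covering homomorphism, and let $Z_H = \ker p$, so that $H = \tilde H / Z_H$. For a path $h : [0,1] \to H$ with $h(0) = e$, let $[h] \in \tilde H$ be the element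 it represents, i.e. the endpoint of the lift of $h$ to $\tilde H$ that starts at $e$. Then $Z_H$ is central in $\tilde H$, the map $c \mapsto [c]$ on loops at $e$ induces a group isomorphism $\pi_1(H,e) \cong Z_H$, and: (i) $(\tilde H, H^\perp)$ forms a matched pair, with a double Lie group whose actions are given, for every path $h$ in $H$ with $h(0) = e$ and every $\gamma \in H^\perp$, by $[h]^\gamma = [h^\gamma]$, where $h^\gamma(t) = h(t)^\gamma$, and ${}^{[h]}\gamma = {}^{h(1)}\gamma$; (ii) for these actions $Z_H$ acts trivially on $H^\perp$, and every element of $Z_H$ is fixed by the action of $H^\perp$: ${}^{z}\gamma = \gamma$ and $z^\gamma = z$ for all $z \in Z_H$, $\gamma \in H^\perp$; (iii) $p$ intertwines the actions of $H^\perp$: $p(\tilde h^\gamma) = p(\tilde h)^\gamma$ for all $\tilde h \in \tilde H$ and $\gamma \in H^\perp$. -/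

import Mathlib

open scoped Manifold ContDiff

universe u v

noncomputable section

/-- The data exhibiting the Lie group `D` as a double Lie group `G₁ ⋈ G₂` of the Lie groups `G₁` and
`G₂`: both are contained in `D` as closed Lie subgroups, through injective smooth homomorphisms
with closed image that are homeomorphisms onto their images, and multiplication
`(g, γ) ↦ g γ` is a diffeomorphism `G₁ × G₂ ≃ D`. The Lie groups `(G₁, G₂)` form a matched pair if
such a `D` exists. -/
structure DoubleLieGroup
    {E₁ M₁ E₂ M₂ V N : Type*}
    [NormedAddCommGroup E₁] [NormedSpace ℝ E₁] [TopologicalSpace M₁]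
    [NormedAddCommGroup E₂] [NormedSpace ℝ E₂] [TopologicalSpace M₂]
    [NormedAddCommGroup V] [NormedSpace ℝ V] [TopologicalSpace N]
    (I₁ : ModelWithCorners ℝ E₁ M₁)
    (G₁ : Type*) [Group G₁] [TopologicalSpace G₁] [ChartedSpace M₁ G₁] [LieGroup I₁ ∞ G₁]
    (I₂ : ModelWithCorners ℝ E₂ M₂)
    (G₂ : Type*) [Group G₂] [TopologicalSpace G₂] [ChartedSpace M₂ G₂] [LieGroup I₂ ∞ G₂]
    (J : ModelWithCorners ℝ V N)
    (D : Type*) [Group D] [TopologicalSpace D] [ChartedSpace N D] [LieGroup J ∞ D] where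
  /-- the inclusion of `G₁` -/
  incl₁ : G₁ →* D
  /-- the inclusion of `G₂` -/
  incl₂ : G₂ →* D
  contMDiff_incl₁ : ContMDiff I₁ J ∞ incl₁
  contMDiff_incl₂ : ContMDiff I₂ J ∞ incl₂
  isClosedEmbedding_incl₁ : Topology.IsClosedEmbedding incl₁
  isClosedEmbedding_incl₂ : Topology.IsClosedEmbedding incl₂
  /-- the product decomposition `D = G₁ G₂` -/
  mulDiffeo : Diffeomorph (I₁.prod I₂) J (G₁ × G₂) D ∞
  mulDiffeo_apply : ∀ g γ, mulDiffeo (g, γ) = incl₁ g * incl₂ γ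

namespace DoubleLieGroup

variable
    {E₁ M₁ E₂ M₂ V N : Type*}
    [NormedAddCommGroup E₁] [NormedSpace ℝ E₁] [TopologicalSpace M₁]
    [NormedAddCommGroup E₂] [NormedSpace ℝ E₂] [TopologicalSpace M₂]
    [NormedAddCommGroup V] [NormedSpace ℝ V] [TopologicalSpace N]
    {I₁ : ModelWithCorners ℝ E₁ M₁}
    {G₁ : Type*} [Group G₁] [TopologicalSpace G₁] [ChartedSpace M₁ G₁] [LieGroup I₁ ∞ G₁]
    {I₂ : ModelWithCorners ℝ E₂ M₂}
    {G₂ : Type*} [Group G₂] [TopologicalSpace G₂] [ChartedSpace M₂ G₂] [LieGroup I₂ ∞ G₂]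
    {J : ModelWithCorners ℝ V N}
    {D : Type*} [Group D] [TopologicalSpace D] [ChartedSpace N D] [LieGroup J ∞ D]
    (𝒟 : DoubleLieGroup I₁ G₁ I₂ G₂ J D)

/-- The left action `(g, γ) ↦ ᵍγ` of `G₁` on `G₂`, given by the factorization `g γ = ᵍγ g^γ` in the
double (see `incl₁_mul_incl₂` and `eq_of_mul_eq`). -/
def left (g : G₁) (γ : G₂) : G₂ :=
  (𝒟.mulDiffeo.symm (𝒟.incl₁ g * 𝒟.incl₂ γ)⁻¹).2⁻¹

/-- The right action `(g, γ) ↦ g^γ` of `G₂` on `G₁`, given by the factorization `g γ = ᵍγ g^γ` in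
the double. -/
def right (g : G₁) (γ : G₂) : G₁ :=
  (𝒟.mulDiffeo.symm (𝒟.incl₁ g * 𝒟.incl₂ γ)⁻¹).1⁻¹

theorem incl₁_mul_incl₂ (g : G₁) (γ : G₂) :
    𝒟.incl₁ g * 𝒟.incl₂ γ = 𝒟.incl₂ (𝒟.left g γ) * 𝒟.incl₁ (𝒟.right g γ) := by
  have h := 𝒟.mulDiffeo.apply_symm_apply (𝒟.incl₁ g * 𝒟.incl₂ γ)⁻¹
  rw [← Prod.mk.eta (p := 𝒟.mulDiffeo.symm _), 𝒟.mulDiffeo_apply] at h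
  rw [left, right, map_inv 𝒟.incl₁, map_inv 𝒟.incl₂, ← mul_inv_rev, h, inv_inv]

theorem eq_of_mul_eq {g g' : G₁} {γ γ' : G₂}
    (h : 𝒟.incl₁ g * 𝒟.incl₂ γ = 𝒟.incl₂ γ' * 𝒟.incl₁ g') :
    𝒟.left g γ = γ' ∧ 𝒟.right g γ = g' := by
  have h2 : (𝒟.incl₁ g * 𝒟.incl₂ γ)⁻¹ = 𝒟.mulDiffeo (g'⁻¹, γ'⁻¹) := by
    rw [𝒟.mulDiffeo_apply, h, mul_inv_rev, map_inv, map_inv]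
  simp [left, right, h2]

theorem right_one_left (γ : G₂) : 𝒟.right 1 γ = 1 :=
  (𝒟.eq_of_mul_eq (γ' := γ) (by simp)).2

theorem continuous_right (γ : G₂) : Continuous fun g => 𝒟.right g γ := by
  have := topologicalGroup_of_lieGroup J ∞ (G := D)
  have := topologicalGroup_of_lieGroup I₁ ∞ (G := G₁)
  have h1 := 𝒟.mulDiffeo.symm.continuous
  have h2 := 𝒟.contMDiff_incl₁.continuous
  unfold right
  fun_prop

/-- The path `h^γ : t ↦ h(t)^γ` in `G₁`, for a path `h` in `G₁` starting at the identity. -/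
def rightPath {g : G₁} (h : Path (1 : G₁) g) (γ : G₂) : Path (1 : G₁) (𝒟.right g γ) where
  toFun t := 𝒟.right (h t) γ
  continuous_toFun := (𝒟.continuous_right γ).comp h.continuous
  source' := by simp [right_one_left]
  target' := by simp

end DoubleLieGroup

/-- `p : Ht → H` is the universal cover of the Lie group `H`: the Lie group `Ht` is connected and
simply connected, and `p` is a smooth covering homomorphism. -/
structure IsUniversalCover
    {E M E' M' : Type*}
    [NormedAddCommGroup E] [NormedSpace ℝ E] [TopologicalSpace M]
    [NormedAddCommGroup E'] [NormedSpace ℝ E'] [TopologicalSpace M']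
    (I' : ModelWithCorners ℝ E' M')
    {Ht : Type*} [Group Ht] [TopologicalSpace Ht] [ChartedSpace M' Ht] [LieGroup I' ∞ Ht]
    (I : ModelWithCorners ℝ E M)
    {H : Type*} [Group H] [TopologicalSpace H] [ChartedSpace M H] [LieGroup I ∞ H]
    (p : Ht →* H) : Prop where
  simplyConnected : SimplyConnectedSpace Ht
  surjective : Function.Surjective p
  isCoveringMap : IsCoveringMap p
  isLocalDiffeomorph : IsLocalDiffeomorph I' I ∞ p

/-- The element `[h]` of the covering group `Ht` represented by a path `h` in `H` starting at the
identity: the endpoint of the lift of `h` that starts at the identity. -/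
def pathClass
    {Ht H : Type*} [Group Ht] [TopologicalSpace Ht] [Group H] [TopologicalSpace H]
    {p : Ht →* H} (hp : IsCoveringMap p) {x : H} (h : Path (1 : H) x) : Ht :=
  hp.liftPath h 1 (by simp) 1

end

/-!
# The universal cover of a factor of a matched pair of Lie groups

The left action of the cover `Ht` on `K` is the action of `H` pulled back along `p`. The right
action of `K` on `Ht` is obtained by lifting the map `(h, γ) ↦ p(h)^γ` from `Ht × K` to `H` through
`p`, with the value `1` on `{1} × K`. The group `K` need not be simply connected, but the
lift exists: since `1^γ = 1`, the map is constant on `{1} × K`, and the loops in this slice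
represent all of `π₁(Ht × K)` because `Ht` is simply connected
(`IsCoveringMap.exists_lift_prod`).

By uniqueness of lifts on connected spaces, the lifted actions inherit the identities of a matched
pair of actions (`DoubleLieGroup.matchedActionsOfLift`), and these identities define a group law on
`Ht × K`. The lifted action is smooth because `p` is a local diffeomorphism
(`IsLocalDiffeomorph.contMDiff_of_comp`), so this group is a double Lie group with the required
actions (`MatchedActions.toDoubleLieGroup`, `MatchedActions.toDoubleLieGroup_left_right`). The description
on paths and the triviality on `ker p` again follow from uniqueness of lifts, as do the centrality of
`ker p` and the isomorphism `π₁(H) ≃ ker p`, `c ↦ [c]`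
(`exists_fundamentalGroup_mulEquiv_ker`).
-/

/-! ### Lifting maps on a product through a covering map -/

section Covering

variable {A B E X : Type*} [TopologicalSpace A] [TopologicalSpace B] [TopologicalSpace E]
  [TopologicalSpace X]

/-- A map `f` on `A × B` that is constant on `{a₀} × B` lifts through a covering map as soon as `A`
is simply connected, although `B` need not be: every loop in `A × B` is homotopic to a loop in
`{a₀} × B`, so `f` is trivial on fundamental groups. The lift can be chosen constant on
`{a₀} × B`. -/
theorem IsCoveringMap.exists_lift_prod [SimplyConnectedSpace A] [LocallyPathConnectedSpace A]
    [PathConnectedSpace B] [LocallyPathConnectedSpace B] {p : E → X} (cov : IsCoveringMap p)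
    (f : C(A × B, X)) {a₀ : A} {e₀ : E} (hf : ∀ b, f (a₀, b) = p e₀) :
    ∃ F : C(A × B, E), (∀ b, F (a₀, b) = e₀) ∧ ∀ x, p (F x) = f x := by
  obtain ⟨b₀⟩ : Nonempty B := inferInstance
  have trivial_map : ∀ c : FundamentalGroup (A × B) (a₀, b₀), FundamentalGroup.map f _ c = 1 := by
    intro c
    obtain ⟨β, hβ⟩ := Path.Homotopic.Quotient.mk_surjective (Path.Homotopic.projRight c)
    have hc : c = Path.Homotopic.Quotient.mk ((Path.refl a₀).prod β) := by
      rw [← Path.Homotopic.prod_projLeft_projRight c, ← hβ,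
        Subsingleton.elim (Path.Homotopic.projLeft c) (.mk (.refl a₀))]
      rfl
    rw [hc, FundamentalGroup.map_apply]
    refine congrArg Path.Homotopic.Quotient.mk (Path.ext (funext fun t => ?_))
    exact (hf _).trans (hf _).symm
  obtain ⟨F, ⟨hF₀, hF⟩, -⟩ := cov.existsUnique_continuousMap_lifts_of_range_le (f := f)
    (a₀ := (a₀, b₀)) (hf b₀).symm (by
      rintro _ ⟨c, rfl⟩
      rw [trivial_map]
      exact one_mem _)
  refine ⟨F, fun b => ?_, congrFun hF⟩
  rw [← hF₀]
  refine cov.const_of_comp (g := fun b => F (a₀, b)) (by fun_prop) (fun b b' => ?_) b b₀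
  have h := fun b => congrFun hF (a₀, b)
  simp only [Function.comp_apply, hf] at h
  rw [h, h]

end Covering

/-! ### Covering homomorphisms of topological groups -/

section CoveringGroup

variable {Ht H : Type*} [Group Ht] [TopologicalSpace Ht] [Group H] [TopologicalSpace H]
  {p : Ht →* H}

/-- For `z` in the kernel, `g ↦ g z g⁻¹` is a continuous map from a connected space to a fibre, hence
constant. -/
theorem IsCoveringMap.ker_le_center [IsTopologicalGroup Ht] [PreconnectedSpace Ht]
    (cov : IsCoveringMap p) : p.ker ≤ Subgroup.center Ht := by
  intro z hz
  rw [MonoidHom.mem_ker] at hz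
  rw [Subgroup.mem_center_iff]
  intro g
  have h := cov.const_of_comp (g := fun g => g * z * g⁻¹) (by fun_prop)
    (fun a b => by simp [hz]) g 1
  simpa [mul_inv_eq_iff_eq_mul] using h

/-- Any lift of `h` starting at `1` computes `[h]`. -/
theorem pathClass_eq_apply_one (cov : IsCoveringMap p) {x : H} (h : Path (1 : H) x)
    {Γ : unitInterval → Ht} (hΓ : Continuous Γ) (hp : ∀ t, p (Γ t) = h t) (h0 : Γ 0 = 1) :
    pathClass cov h = Γ 1 :=
  (congrFun ((cov.eq_liftPath_iff (γ := (h : C(unitInterval, H))) (e := 1) (by simp)).2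
    ⟨hΓ, funext hp, h0⟩) 1).symm

theorem map_pathClass (cov : IsCoveringMap p) {x : H} (h : Path (1 : H) x) :
    p (pathClass cov h) = x :=
  (congrFun (cov.liftPath_lifts h 1 (by simp)) 1).trans h.target

theorem pathClass_eq_iff_homotopic [SimplyConnectedSpace Ht] (cov : IsCoveringMap p) {x : H}
    {c c' : Path (1 : H) x} : pathClass cov c = pathClass cov c' ↔ c.Homotopic c' := by
  refine ⟨fun h => ?_, fun h => cov.liftPath_apply_one_eq_of_homotopicRel h _ _ _⟩
  let Γ : Path (1 : Ht) (pathClass cov c) :=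
    ⟨cov.liftPath c 1 (by simp), cov.liftPath_zero _ _ _, rfl⟩
  let Γ' : Path (1 : Ht) (pathClass cov c) :=
    ⟨cov.liftPath c' 1 (by simp), cov.liftPath_zero _ _ _, h.symm⟩
  have key := (cov.homotopicRel_iff_comp
    ⟨0, .inl rfl, Γ.source.trans Γ'.source.symm⟩).1 (SimplyConnectedSpace.paths_homotopic Γ Γ')
  have hΓ : (ContinuousMap.comp ⟨p, cov.continuous⟩ Γ.toContinuousMap) = c.toContinuousMap :=
    ContinuousMap.ext (congrFun (cov.liftPath_lifts c 1 (by simp)))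
  have hΓ' : (ContinuousMap.comp ⟨p, cov.continuous⟩ Γ'.toContinuousMap) = c'.toContinuousMap :=
    ContinuousMap.ext (congrFun (cov.liftPath_lifts c' 1 (by simp)))
  rw [hΓ, hΓ'] at key
  exact key

/-- The lift of `c · c'` is the lift of `c` followed by the lift of `c'` translated by `[c]`. -/
theorem pathClass_trans [ContinuousMul Ht] (cov : IsCoveringMap p) (c c' : Path (1 : H) 1) :
    pathClass cov (c.trans c') = pathClass cov c * pathClass cov c' := by
  have h := congrArg Subtype.val (cov.monodromy_trans_apply (.mk c) (.mk c') ⟨1, map_one p⟩)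
  refine h.trans ?_
  set z : Ht := pathClass cov c
  have hz : p z = 1 := map_pathClass cov c
  refine (congrFun ((cov.eq_liftPath_iff (γ := (c' : C(unitInterval, H))) (e := z)
    (Γ := fun t => z * cov.liftPath c' 1 (by simp) t) (by simp [hz])).2
    ⟨by fun_prop, funext fun t => ?_, ?_⟩) 1).symm
  · have := congrFun (cov.liftPath_lifts (c' : C(unitInterval, H)) 1 (by simp)) t
    simpa [hz] using this
  · simp [cov.liftPath_zero]

/-- The map `c ↦ [c]` is an isomorphism from the fundamental group to the kernel of a simply connected
covering. Multiplication in `FundamentalGroup` is concatenation in the opposite order, which is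
harmless because the kernel is central. -/
theorem exists_fundamentalGroup_mulEquiv_ker [IsTopologicalGroup Ht] [SimplyConnectedSpace Ht]
    (cov : IsCoveringMap p) :
    ∃ φ : FundamentalGroup H 1 ≃* p.ker, ∀ c : Path (1 : H) 1,
      (φ (FundamentalGroup.fromPath (Path.Homotopic.Quotient.mk c)) : Ht) = pathClass cov c := by
  let f : FundamentalGroup H 1 → p.ker := fun c =>
    ⟨cov.monodromy c ⟨1, map_one p⟩, (cov.monodromy c ⟨1, map_one p⟩).2⟩
  have hf : ∀ c : Path (1 : H) 1, (f (Path.Homotopic.Quotient.mk c) : Ht) = pathClass cov c :=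
    fun c => rfl
  have f_mul : ∀ a b, f (a * b) = f a * f b := by
    intro a b
    obtain ⟨α, rfl⟩ := Path.Homotopic.Quotient.mk_surjective a
    obtain ⟨β, rfl⟩ := Path.Homotopic.Quotient.mk_surjective b
    refine Subtype.ext ?_
    rw [FundamentalGroup.mul_def, ← Path.Homotopic.Quotient.mk_trans, hf, pathClass_trans,
      Subgroup.coe_mul, hf, hf]
    exact (Subgroup.mem_center_iff.1 (cov.ker_le_center (map_pathClass cov α)) _)
  have f_bij : Function.Bijective f := by
    constructor
    · intro a b h
      obtain ⟨α, rfl⟩ := Path.Homotopic.Quotient.mk_surjective a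
      obtain ⟨β, rfl⟩ := Path.Homotopic.Quotient.mk_surjective b
      exact Path.Homotopic.Quotient.eq.2 ((pathClass_eq_iff_homotopic cov).1
        (congrArg Subtype.val h))
    · rintro ⟨z, hz⟩
      let Γ := PathConnectedSpace.somePath (1 : Ht) z
      refine ⟨Path.Homotopic.Quotient.mk
        ((Γ.map cov.continuous).cast (map_one p).symm (MonoidHom.mem_ker.1 hz).symm), ?_⟩
      refine Subtype.ext ?_
      rw [hf, pathClass_eq_apply_one cov _ Γ.continuous (fun t => rfl) Γ.source, Γ.target]
  exact ⟨MulEquiv.mk' (Equiv.ofBijective f f_bij) f_mul, hf⟩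

end CoveringGroup

/-! ### Slices of a product -/

section ProductEmbedding

variable {X Y : Type*} [TopologicalSpace X] [TopologicalSpace Y]

theorem isClosedEmbedding_prodMkLeft [T1Space Y] (y : Y) :
    Topology.IsClosedEmbedding fun x : X => (x, y) :=
  ⟨isEmbedding_prodMkLeft y, by
    have h : Set.range (fun x : X => (x, y)) = Prod.snd ⁻¹' {y} := by
      ext ⟨a, b⟩
      simp [eq_comm]
    rw [h]
    exact isClosed_singleton.preimage continuous_snd⟩

theorem isClosedEmbedding_prodMkRight [T1Space X] (x : X) :
    Topology.IsClosedEmbedding fun y : Y => (x, y) :=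
  ⟨isEmbedding_prodMkRight x, by
    have h : Set.range (fun y : Y => (x, y)) = Prod.fst ⁻¹' {x} := by
      ext ⟨a, b⟩
      simp [eq_comm]
    rw [h]
    exact isClosed_singleton.preimage continuous_fst⟩

end ProductEmbedding

/-! ### Matched pairs of actions and their double -/

/-- A matched pair of actions: a left action `left g γ = ᵍγ` of `G₁` on the set `G₂` and a right
action `right g γ = g^γ` of `G₂` on the set `G₁`, such that `ᵍ(γδ) = ᵍγ · ^(g^γ)δ` and
`(gh)^γ = g^(ʰγ) · h^γ`. These are the identities that the factorization `g γ = ᵍγ g^γ` in a group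
forces on the two factors. -/
structure MatchedActions (G₁ G₂ : Type*) [Group G₁] [Group G₂] where
  /-- the left action `ᵍγ` of `G₁` on `G₂` -/
  left : G₁ → G₂ → G₂
  /-- the right action `g^γ` of `G₂` on `G₁` -/
  right : G₁ → G₂ → G₁
  left_one_left : ∀ γ, left 1 γ = γ
  right_one_right : ∀ g, right g 1 = g
  left_mul_left : ∀ g h γ, left (g * h) γ = left g (left h γ)
  right_mul_right : ∀ g γ δ, right g (γ * δ) = right (right g γ) δ
  left_mul_right : ∀ g γ δ, left g (γ * δ) = left g γ * left (right g γ) δ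
  right_mul_left : ∀ g h γ, right (g * h) γ = right g (left h γ) * right h γ

namespace MatchedActions

section Algebra

variable {G₁ G₂ : Type*} [Group G₁] [Group G₂] (A : MatchedActions G₁ G₂)

attribute [simp] left_one_left right_one_right

@[simp]
theorem left_one_right (g : G₁) : A.left g 1 = 1 := by
  have h := A.left_mul_right g 1 1
  rw [A.right_one_right, mul_one] at h
  exact left_eq_mul.1 h

@[simp]
theorem right_one_left (γ : G₂) : A.right 1 γ = 1 := by
  have h := A.right_mul_left 1 1 γ
  rw [A.left_one_left, mul_one] at h
  exact left_eq_mul.1 h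

theorem left_inv_right (g : G₁) (γ : G₂) : A.left (A.right g γ) γ⁻¹ = (A.left g γ)⁻¹ :=
  eq_inv_of_mul_eq_one_right (by rw [← A.left_mul_right, mul_inv_cancel, A.left_one_right])

theorem right_inv_left (g : G₁) (γ : G₂) : A.right g⁻¹ (A.left g γ) = (A.right g γ)⁻¹ := by
  rw [eq_inv_iff_mul_eq_one, ← A.right_mul_left, inv_mul_cancel, A.right_one_left]

theorem left_right_inv_left_inv (g : G₁) (γ : G₂) :
    A.left (A.right g γ)⁻¹ (A.left g γ)⁻¹ = γ⁻¹ := by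
  rw [← A.left_inv_right, ← A.left_mul_left, inv_mul_cancel, A.left_one_left]

theorem right_right_inv_left_inv (g : G₁) (γ : G₂) :
    A.right (A.right g γ)⁻¹ (A.left g γ)⁻¹ = g⁻¹ := by
  rw [← A.left_inv_right, A.right_inv_left, ← A.right_mul_right, mul_inv_cancel,
    A.right_one_right]

/-- The double of a matched pair of actions: the set `G₁ × G₂`, where `(g, γ)` stands for the
product `g γ`. It is a type synonym, since its group law is not the componentwise one. -/
def Double (_ : MatchedActions G₁ G₂) : Type _ := G₁ × G₂

namespace Double

/-- The law `(a b)(c d) = a (b c) d`, where `b c = (c⁻¹ b⁻¹)⁻¹` is rewritten with its `G₁`-factor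
first by inverting the factorization `c⁻¹ b⁻¹ = ^(c⁻¹)(b⁻¹) · (c⁻¹)^(b⁻¹)`. -/
instance : Mul A.Double :=
  ⟨fun x y => (x.1 * (A.right y.1⁻¹ x.2⁻¹)⁻¹, (A.left y.1⁻¹ x.2⁻¹)⁻¹ * y.2)⟩

instance : One A.Double := ⟨((1 : G₁), (1 : G₂))⟩

/-- The inverse `(a b)⁻¹ = (ᵃb · a^b)⁻¹ = (a^b)⁻¹ (ᵃb)⁻¹`. -/
instance : Inv A.Double := ⟨fun x => ((A.right x.1 x.2)⁻¹, (A.left x.1 x.2)⁻¹)⟩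

instance : Group A.Double :=
  Group.ofLeftAxioms
    (by
      rintro ⟨a, b⟩ ⟨c, d⟩ ⟨e, f⟩
      refine Prod.ext (?_ : a * (A.right c⁻¹ b⁻¹)⁻¹ *
          (A.right e⁻¹ ((A.left c⁻¹ b⁻¹)⁻¹ * d)⁻¹)⁻¹ =
        a * (A.right (c * (A.right e⁻¹ d⁻¹)⁻¹)⁻¹ b⁻¹)⁻¹)
        (?_ : (A.left e⁻¹ ((A.left c⁻¹ b⁻¹)⁻¹ * d)⁻¹)⁻¹ * f =
        (A.left (c * (A.right e⁻¹ d⁻¹)⁻¹)⁻¹ b⁻¹)⁻¹ * ((A.left e⁻¹ d⁻¹)⁻¹ * f))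
      · simp [A.right_mul_right, A.right_mul_left, mul_assoc]
      · simp [A.left_mul_left, A.left_mul_right, mul_assoc])
    (by
      rintro ⟨a, b⟩
      refine Prod.ext (?_ : 1 * (A.right a⁻¹ 1⁻¹)⁻¹ = a) (?_ : (A.left a⁻¹ 1⁻¹)⁻¹ * b = b)
      · simp [A.right_one_right]
      · simp [A.left_one_right])
    (by
      rintro ⟨a, b⟩
      refine Prod.ext (?_ : (A.right a b)⁻¹ * (A.right a⁻¹ (A.left a b)⁻¹⁻¹)⁻¹ = 1)
        (?_ : (A.left a⁻¹ (A.left a b)⁻¹⁻¹)⁻¹ * b = 1)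
      · simp [A.right_inv_left]
      · simp [← A.left_mul_left, A.left_one_left])

/-- The inclusion `g ↦ (g, 1)` of `G₁` into the double. -/
def inclLeft : G₁ →* A.Double :=
  MonoidHom.mk' (fun g => ((g, 1) : G₁ × G₂)) fun g h =>
    Prod.ext (by simp : g * h = g * (A.right h⁻¹ 1⁻¹)⁻¹) (by simp : 1 = (A.left h⁻¹ 1⁻¹)⁻¹ * 1)

/-- The inclusion `γ ↦ (1, γ)` of `G₂` into the double. -/
def inclRight : G₂ →* A.Double :=
  MonoidHom.mk' (fun γ => ((1, γ) : G₁ × G₂)) fun γ δ =>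
    Prod.ext (by simp : 1 = 1 * (A.right 1⁻¹ γ⁻¹)⁻¹) (by simp : γ * δ = (A.left 1⁻¹ γ⁻¹)⁻¹ * δ)

theorem inclLeft_mul_inclRight (g : G₁) (γ : G₂) :
    inclLeft A g * inclRight A γ = ((g, γ) : G₁ × G₂) :=
  Prod.ext (by simp : g * (A.right 1⁻¹ 1⁻¹)⁻¹ = g) (by simp : (A.left 1⁻¹ 1⁻¹)⁻¹ * γ = γ)

end Double

end Algebra

section Smooth

variable {E₁ M₁ E₂ M₂ : Type*}
  [NormedAddCommGroup E₁] [NormedSpace ℝ E₁] [TopologicalSpace M₁]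
  [NormedAddCommGroup E₂] [NormedSpace ℝ E₂] [TopologicalSpace M₂]
  {I₁ : ModelWithCorners ℝ E₁ M₁}
  {G₁ : Type*} [Group G₁] [TopologicalSpace G₁] [ChartedSpace M₁ G₁] [LieGroup I₁ ∞ G₁]
  {I₂ : ModelWithCorners ℝ E₂ M₂}
  {G₂ : Type*} [Group G₂] [TopologicalSpace G₂] [ChartedSpace M₂ G₂] [LieGroup I₂ ∞ G₂]
  (A : MatchedActions G₁ G₂)

instance : TopologicalSpace A.Double := inferInstanceAs (TopologicalSpace (G₁ × G₂))

instance : ChartedSpace (ModelProd M₁ M₂) A.Double :=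
  inferInstanceAs (ChartedSpace (ModelProd M₁ M₂) (G₁ × G₂))

theorem lieGroup_double
    (hl : ContMDiff (I₁.prod I₂) I₂ ∞ fun x : G₁ × G₂ => A.left x.1 x.2)
    (hr : ContMDiff (I₁.prod I₂) I₁ ∞ fun x : G₁ × G₂ => A.right x.1 x.2) :
    LieGroup (I₁.prod I₂) ∞ A.Double where
  toIsManifold := inferInstanceAs (IsManifold (I₁.prod I₂) ∞ (G₁ × G₂))
  contMDiff_mul := by
    change ContMDiff ((I₁.prod I₂).prod (I₁.prod I₂)) (I₁.prod I₂) ∞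
      fun x : (G₁ × G₂) × (G₁ × G₂) =>
        (x.1.1 * (A.right x.2.1⁻¹ x.1.2⁻¹)⁻¹, (A.left x.2.1⁻¹ x.1.2⁻¹)⁻¹ * x.2.2)
    have h : ContMDiff ((I₁.prod I₂).prod (I₁.prod I₂)) (I₁.prod I₂) ∞
        fun x : (G₁ × G₂) × (G₁ × G₂) => (x.2.1⁻¹, x.1.2⁻¹) :=
      contMDiff_snd.fst.inv.prodMk contMDiff_fst.snd.inv
    exact (contMDiff_fst.fst.mul (hr.comp h).inv).prodMk ((hl.comp h).inv.mul contMDiff_snd.snd)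
  contMDiff_inv := hr.inv.prodMk hl.inv

/-- A matched pair of smooth actions makes `G₁ × G₂`, with its product manifold structure, a double
Lie group of `G₁` and `G₂`. -/
noncomputable def toDoubleLieGroup [T1Space G₁] [T1Space G₂]
    (hl : ContMDiff (I₁.prod I₂) I₂ ∞ fun x : G₁ × G₂ => A.left x.1 x.2)
    (hr : ContMDiff (I₁.prod I₂) I₁ ∞ fun x : G₁ × G₂ => A.right x.1 x.2) :
    haveI := A.lieGroup_double hl hr
    DoubleLieGroup I₁ G₁ I₂ G₂ (I₁.prod I₂) A.Double :=
  haveI := A.lieGroup_double hl hr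
  { incl₁ := Double.inclLeft A
    incl₂ := Double.inclRight A
    contMDiff_incl₁ := contMDiff_id.prodMk contMDiff_const
    contMDiff_incl₂ := contMDiff_const.prodMk contMDiff_id
    isClosedEmbedding_incl₁ := isClosedEmbedding_prodMkLeft (1 : G₂)
    isClosedEmbedding_incl₂ := isClosedEmbedding_prodMkRight (1 : G₁)
    mulDiffeo := Diffeomorph.refl (I₁.prod I₂) (G₁ × G₂) ∞
    mulDiffeo_apply := fun g γ => (Double.inclLeft_mul_inclRight A g γ).symm }

/-- The actions defined by the double Lie group of a matched pair of smooth actions are the given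
ones. -/
theorem toDoubleLieGroup_left_right [T1Space G₁] [T1Space G₂]
    (hl : ContMDiff (I₁.prod I₂) I₂ ∞ fun x : G₁ × G₂ => A.left x.1 x.2)
    (hr : ContMDiff (I₁.prod I₂) I₁ ∞ fun x : G₁ × G₂ => A.right x.1 x.2) (g : G₁) (γ : G₂) :
    haveI := A.lieGroup_double hl hr
    (A.toDoubleLieGroup hl hr).left g γ = A.left g γ ∧
      (A.toDoubleLieGroup hl hr).right g γ = A.right g γ := by
  have := A.lieGroup_double hl hr
  refine (A.toDoubleLieGroup hl hr).eq_of_mul_eq ?_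
  rw [← DoubleLieGroup.mulDiffeo_apply]
  -- Unfold the product `(1, ᵍγ) (g^γ, 1)` in the double.
  change ((g, γ) : G₁ × G₂) = (1 * (A.right (A.right g γ)⁻¹ (A.left g γ)⁻¹)⁻¹,
    (A.left (A.right g γ)⁻¹ (A.left g γ)⁻¹)⁻¹ * 1)
  simp [A.left_right_inv_left_inv, A.right_right_inv_left_inv]

end Smooth

end MatchedActions

/-! ### The actions of a double Lie group -/

namespace DoubleLieGroup

variable {E₁ M₁ E₂ M₂ V N : Type*}
  [NormedAddCommGroup E₁] [NormedSpace ℝ E₁] [TopologicalSpace M₁]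
  [NormedAddCommGroup E₂] [NormedSpace ℝ E₂] [TopologicalSpace M₂]
  [NormedAddCommGroup V] [NormedSpace ℝ V] [TopologicalSpace N]
  {I₁ : ModelWithCorners ℝ E₁ M₁}
  {G₁ : Type*} [Group G₁] [TopologicalSpace G₁] [ChartedSpace M₁ G₁] [LieGroup I₁ ∞ G₁]
  {I₂ : ModelWithCorners ℝ E₂ M₂}
  {G₂ : Type*} [Group G₂] [TopologicalSpace G₂] [ChartedSpace M₂ G₂] [LieGroup I₂ ∞ G₂]
  {J : ModelWithCorners ℝ V N}
  {D : Type*} [Group D] [TopologicalSpace D] [ChartedSpace N D] [LieGroup J ∞ D]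
  (𝒟 : DoubleLieGroup I₁ G₁ I₂ G₂ J D)

/-- The factorization of `(g h) γ = g (h γ)`. -/
theorem mul_factorization (g h : G₁) (γ : G₂) :
    𝒟.left (g * h) γ = 𝒟.left g (𝒟.left h γ) ∧
      𝒟.right (g * h) γ = 𝒟.right g (𝒟.left h γ) * 𝒟.right h γ :=
  𝒟.eq_of_mul_eq (by
    rw [map_mul, mul_assoc, incl₁_mul_incl₂, ← mul_assoc, incl₁_mul_incl₂, map_mul, mul_assoc])

/-- The factorization of `g (γ δ) = (g γ) δ`. -/
theorem factorization_mul (g : G₁) (γ δ : G₂) :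
    𝒟.left g (γ * δ) = 𝒟.left g γ * 𝒟.left (𝒟.right g γ) δ ∧
      𝒟.right g (γ * δ) = 𝒟.right (𝒟.right g γ) δ :=
  𝒟.eq_of_mul_eq (by
    rw [map_mul, ← mul_assoc, incl₁_mul_incl₂, mul_assoc, incl₁_mul_incl₂, map_mul, mul_assoc])

theorem left_one_left (γ : G₂) : 𝒟.left 1 γ = γ :=
  (𝒟.eq_of_mul_eq (g' := 1) (by simp)).1

theorem right_one_right (g : G₁) : 𝒟.right g 1 = g :=
  (𝒟.eq_of_mul_eq (γ' := 1) (by simp)).2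

theorem contMDiff_mulDiffeo_symm_inv :
    ContMDiff (I₁.prod I₂) (I₁.prod I₂) ∞ fun x : G₁ × G₂ =>
      𝒟.mulDiffeo.symm (𝒟.incl₁ x.1 * 𝒟.incl₂ x.2)⁻¹ :=
  𝒟.mulDiffeo.symm.contMDiff.comp ((𝒟.contMDiff_incl₁.comp contMDiff_fst).mul
    (𝒟.contMDiff_incl₂.comp contMDiff_snd)).inv

theorem contMDiff_left :
    ContMDiff (I₁.prod I₂) I₂ ∞ fun x : G₁ × G₂ => 𝒟.left x.1 x.2 :=
  𝒟.contMDiff_mulDiffeo_symm_inv.snd.inv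

theorem contMDiff_right :
    ContMDiff (I₁.prod I₂) I₁ ∞ fun x : G₁ × G₂ => 𝒟.right x.1 x.2 :=
  𝒟.contMDiff_mulDiffeo_symm_inv.fst.inv

/-- The matched pair of actions on a covering group `Ht` of `G₁` given by a lift `r` of the right
action: `ᵍγ = ^(p g)γ` and `g^γ = r (g, γ)`. An identity between elements
of `Ht` holds because its two sides are continuous in a variable of the connected group `Ht`, agree
when that variable is `1`, and have the same image under `p`. -/
noncomputable def matchedActionsOfLift {Ht : Type*} [Group Ht] [TopologicalSpace Ht]
    [IsTopologicalGroup Ht] [PreconnectedSpace Ht] {p : Ht →* G₁}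
    (cov : IsCoveringMap p) (r : C(Ht × G₂, Ht)) (r_one : ∀ γ, r (1, γ) = 1)
    (r_lift : ∀ x, p (r x) = 𝒟.right (p x.1) x.2) : MatchedActions Ht G₂ where
  left g γ := 𝒟.left (p g) γ
  right g γ := r (g, γ)
  left_one_left γ := by rw [map_one, 𝒟.left_one_left]
  right_one_right g := by
    refine congrFun (cov.eq_of_comp_eq (g₁ := fun g => r (g, 1)) (g₂ := id) (by fun_prop)
      continuous_id (funext fun g => ?_) 1 (r_one 1)) g
    simp [r_lift, 𝒟.right_one_right]
  left_mul_left g h γ := by rw [map_mul, (𝒟.mul_factorization _ _ _).1]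
  right_mul_right g γ δ := by
    refine congrFun (cov.eq_of_comp_eq (g₁ := fun g => r (g, γ * δ))
      (g₂ := fun g => r (r (g, γ), δ)) (by fun_prop) (by fun_prop) (funext fun g => ?_) 1
      (by simp [r_one])) g
    simp [r_lift, (𝒟.factorization_mul _ _ _).2]
  left_mul_right g γ δ := by rw [r_lift, (𝒟.factorization_mul _ _ _).1]
  right_mul_left g h γ := by
    -- For fixed `h`, uniqueness of lifts in the variable `g`.
    have := topologicalGroup_of_lieGroup I₂ ∞ (G := G₂)
    refine congrFun (cov.eq_of_comp_eq (g₁ := fun g => r (g * h, γ))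
      (g₂ := fun g => r (g, 𝒟.left (p h) γ) * r (h, γ)) (by fun_prop) (by fun_prop)
      (funext fun g => ?_) 1 (by simp [r_one])) g
    simp [r_lift, (𝒟.mul_factorization _ _ _).2]

end DoubleLieGroup

/-! ### Smoothness of lifts -/

/-- A continuous lift of a smooth map through a local diffeomorphism is smooth. -/
theorem IsLocalDiffeomorph.contMDiff_of_comp {𝕜 E M E' M' E'' M'' : Type*}
    [NontriviallyNormedField 𝕜]
    [NormedAddCommGroup E] [NormedSpace 𝕜 E] [TopologicalSpace M] {I : ModelWithCorners 𝕜 E M}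
    [NormedAddCommGroup E'] [NormedSpace 𝕜 E'] [TopologicalSpace M']
    {I' : ModelWithCorners 𝕜 E' M'}
    [NormedAddCommGroup E''] [NormedSpace 𝕜 E''] [TopologicalSpace M'']
    {I'' : ModelWithCorners 𝕜 E'' M''}
    {X Y Z : Type*} [TopologicalSpace X] [ChartedSpace M X] [TopologicalSpace Y]
    [ChartedSpace M' Y] [TopologicalSpace Z] [ChartedSpace M'' Z] {n : WithTop ℕ∞}
    {p : Y → Z} (hp : IsLocalDiffeomorph I' I'' n p) {f : X → Y} (hf : Continuous f)
    (hpf : ContMDiff I I'' n (p ∘ f)) : ContMDiff I I' n f := by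
  intro x
  refine ((hp (f x)).localInverse_contMDiffAt.comp x (hpf x)).congr_of_eventuallyEq ?_
  exact (hf.continuousAt.eventually (hp (f x)).localInverse_eventuallyEq_left).mono
    fun y hy => hy.symm

/-! ### The universal cover of a factor of a matched pair -/

theorem mainTheorem6
    {E F V : Type*}
    [NormedAddCommGroup E] [NormedSpace ℝ E] [FiniteDimensional ℝ E]
    [NormedAddCommGroup F] [NormedSpace ℝ F] [FiniteDimensional ℝ F]
    [NormedAddCommGroup V] [NormedSpace ℝ V] [FiniteDimensional ℝ V]
    -- connected Lie groups `H` and `K = H^⊥` forming a matched pair, with double Lie group `D`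
    {H : Type*} [Group H] [TopologicalSpace H] [ChartedSpace E H] [LieGroup 𝓘(ℝ, E) ∞ H]
    [ConnectedSpace H]
    {K : Type u} [Group K] [TopologicalSpace K] [ChartedSpace F K] [LieGroup 𝓘(ℝ, F) ∞ K]
    [ConnectedSpace K]
    {D : Type*} [Group D] [TopologicalSpace D] [ChartedSpace V D] [LieGroup 𝓘(ℝ, V) ∞ D]
    (𝒟 : DoubleLieGroup 𝓘(ℝ, E) H 𝓘(ℝ, F) K 𝓘(ℝ, V) D)
    -- the universal cover of `H`
    {Ht : Type v} [Group Ht] [TopologicalSpace Ht] [ChartedSpace E Ht] [LieGroup 𝓘(ℝ, E) ∞ Ht]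
    (p : Ht →* H) (hp : IsUniversalCover 𝓘(ℝ, E) 𝓘(ℝ, E) p) :
    -- `Z_H = ker p` is central and is `π₁(H)`, realized by classes of loops
    p.ker ≤ Subgroup.center Ht ∧
    (∃ φ : FundamentalGroup H 1 ≃* p.ker, ∀ c : Path (1 : H) 1,
      (φ (FundamentalGroup.fromPath (Path.Homotopic.Quotient.mk c)) : Ht) =
        pathClass hp.isCoveringMap c) ∧
    -- `(Ht, K)` is a matched pair
    ∃ (Dt : Type (max u v)) (_ : Group Dt) (_ : TopologicalSpace Dt)
      (_ : ChartedSpace (ModelProd E F) Dt) (_ : LieGroup (𝓘(ℝ, E).prod 𝓘(ℝ, F)) ∞ Dt)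
      (𝒟t : DoubleLieGroup 𝓘(ℝ, E) Ht 𝓘(ℝ, F) K (𝓘(ℝ, E).prod 𝓘(ℝ, F)) Dt),
      -- the actions are given on paths by `[h]^γ = [h^γ]` and `^[h]γ = ^{h(1)}γ`
      (∀ (x : H) (h : Path (1 : H) x) (γ : K),
        𝒟t.right (pathClass hp.isCoveringMap h) γ =
            pathClass hp.isCoveringMap (𝒟.rightPath h γ) ∧
          𝒟t.left (pathClass hp.isCoveringMap h) γ = 𝒟.left x γ) ∧
      -- `Z_H` acts trivially on `K` and is fixed pointwise by the action of `K`
      (∀ z ∈ p.ker, ∀ γ : K, 𝒟t.left z γ = γ ∧ 𝒟t.right z γ = z) ∧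
      -- `p` intertwines the actions of `K`
      (∀ (h : Ht) (γ : K), p (𝒟t.right h γ) = 𝒟.right (p h) γ) := by
  have cov := hp.isCoveringMap
  have := hp.simplyConnected
  have := topologicalGroup_of_lieGroup 𝓘(ℝ, E) ∞ (G := Ht)
  have : LocallyPathConnectedSpace Ht := ChartedSpace.locallyPathConnectedSpace E Ht
  have : LocallyPathConnectedSpace K := ChartedSpace.locallyPathConnectedSpace F K
  have : PathConnectedSpace K := pathConnectedSpace_iff_connectedSpace.2 inferInstance
  have : T1Space Ht := ChartedSpace.t1Space E Ht
  have : T1Space K := ChartedSpace.t1Space F K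
  obtain ⟨r, r_one, r_lift⟩ := cov.exists_lift_prod
    ⟨fun x : Ht × K => 𝒟.right (p x.1) x.2, 𝒟.contMDiff_right.continuous.comp
      ((cov.continuous.comp continuous_fst).prodMk continuous_snd)⟩
    (a₀ := 1) (e₀ := 1) (fun γ => by simp [𝒟.right_one_left])
  replace r_lift : ∀ x, p (r x) = 𝒟.right (p x.1) x.2 := r_lift
  have p_smooth : ContMDiff (𝓘(ℝ, E).prod 𝓘(ℝ, F)) (𝓘(ℝ, E).prod 𝓘(ℝ, F)) ∞
      fun x : Ht × K => (p x.1, x.2) :=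
    (hp.isLocalDiffeomorph.contMDiff.comp contMDiff_fst).prodMk contMDiff_snd
  let A := 𝒟.matchedActionsOfLift cov r r_one r_lift
  have hl : ContMDiff (𝓘(ℝ, E).prod 𝓘(ℝ, F)) 𝓘(ℝ, F) ∞ fun x : Ht × K => A.left x.1 x.2 :=
    𝒟.contMDiff_left.comp p_smooth
  have hr : ContMDiff (𝓘(ℝ, E).prod 𝓘(ℝ, F)) 𝓘(ℝ, E) ∞ fun x : Ht × K => A.right x.1 x.2 :=
    hp.isLocalDiffeomorph.contMDiff_of_comp r.continuous
      ((funext r_lift : p ∘ r = _) ▸ 𝒟.contMDiff_right.comp p_smooth)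
  have left_eq := fun g γ => (A.toDoubleLieGroup_left_right hl hr g γ).1
  have right_eq := fun g γ => (A.toDoubleLieGroup_left_right hl hr g γ).2
  refine ⟨cov.ker_le_center, exists_fundamentalGroup_mulEquiv_ker cov, A.Double, inferInstance,
    inferInstance, inferInstance, A.lieGroup_double hl hr, A.toDoubleLieGroup hl hr,
    fun x h γ => ⟨?_, ?_⟩, fun z hz γ => ⟨?_, ?_⟩, fun h γ => ?_⟩
  · -- The image under `^γ` of the lift of `h` is a lift of `h^γ`.
    rw [right_eq]
    refine (pathClass_eq_apply_one cov (𝒟.rightPath h γ)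
      (Γ := fun t => r (cov.liftPath h 1 (by simp) t, γ)) (by fun_prop) (fun t => ?_) ?_).symm
    · rw [r_lift]
      exact congrArg (𝒟.right · γ) (congrFun (cov.liftPath_lifts h 1 (by simp)) t)
    · rw [cov.liftPath_zero, r_one]
  · rw [left_eq]
    exact congrArg (𝒟.left · γ) (map_pathClass cov h)
  · rw [left_eq]
    exact (congrArg (𝒟.left · γ) (MonoidHom.mem_ker.1 hz)).trans (𝒟.left_one_left γ)
  · -- `γ ↦ z^γ` maps the connected group `K` into the fibre of `p` over `1`.
    rw [right_eq]
    have p_one : ∀ γ, p (r (z, γ)) = 1 := fun γ => by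
      rw [r_lift, MonoidHom.mem_ker.1 hz, 𝒟.right_one_left]
    exact (cov.const_of_comp (g := fun γ => r (z, γ)) (by fun_prop)
      (fun γ δ => (p_one γ).trans (p_one δ).symm) γ 1).trans (A.right_one_right z)
  · rw [right_eq]
    exact r_lift (h, γ)
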